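/- Let $N\ge 2$ and $0\le t\le \frac1N$. Consider $N$ parties, each holding one qubit, in the pure state $$|\vec t\,\rangle=\sqrt{1-Nt}\,|00\cdots0\rangle+\sqrt t\,\bigl(|10\cdots0\rangle+|01\cdots0\rangle+\cdots+|00\cdots1\rangle\bigr),$$ and let $|W_N\rangle=\sqrt{\tfrac1N}\,\bigl(|10\cdots0\rangle+|01\cdots0\rangle+\cdots+|00\cdots1\rangle\bigr)$. In an LOCC protocol the parties act in a finite number of rounds; in each round one party, chosen depending on the earlier classical outcomes, applies to its qubit and a local finite-dimensional ancilla a quantum instrument with finitely many outcomes (also chosen depending on the earlier outcomes) and announces the outcome to all parties. Let $P(\vec t\to W_N)$ be the supremum, over all LOCC protocols (with arbitrary finite local ancilla dimensions) started in $|\vec t\,\rangle$, of the total probability of those branches at whose end the qubits are exactly in the state $|W_N\rangle$. Then $$P(\vec t\to W_N)\le \frac N2\Bigl(1-\sqrt{1-4(N-1)t^2}\Bigr),$$ and if $0<t<\frac1N$, then moreover $$\frac N2\Bigl(1-\sqrt{1-4(N-1)t^2}\Bigr)<Nt .$$ -/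

import Mathlib

open scoped Matrix BigOperators

noncomputable section

namespace WClass

open scoped ComplexOrder

/-! Pure states of `N` qubits are vectors `(Fin N → Fin 2) → ℂ` of amplitudes in the
computational basis. -/

/-- The vector of amplitudes `√x₀ |00…0⟩ + √x₁ |10…0⟩ + ⋯ + √x_N |00…1⟩`, where
`x₀ = 1 - (x₁ + ⋯ + x_N)`; this is the state denoted by the vector `(x₁, …, x_N)`. -/
def wState {N : ℕ} (x : Fin N → ℝ) : (Fin N → Fin 2) → ℂ :=
  ((√(1 - ∑ i, x i) : ℝ) : ℂ) • Pi.single (fun _ => 0) 1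
    + ∑ i, ((√(x i) : ℝ) : ℂ) • Pi.single (Pi.single i 1) 1

/-- The standard W state `√(1/N) (|10…0⟩ + ⋯ + |00…1⟩)`. -/
def standardW (N : ℕ) : (Fin N → Fin 2) → ℂ :=
  wState (fun _ => 1 / (N : ℝ))

/-- Basis labels of the system held by party `k`: its qubit together with a local ancilla of
(arbitrary finite) dimension `a k + 1`. -/
abbrev Loc {N : ℕ} (a : Fin N → ℕ) (k : Fin N) : Type := Fin 2 × Fin (a k + 1)

/-- Basis labels of the joint system of all parties, ancillas included. -/
abbrev Glob {N : ℕ} (a : Fin N → ℕ) : Type := ∀ k, Loc a k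

/-- The operator `1 ⊗ ⋯ ⊗ A ⊗ ⋯ ⊗ 1` with `A` acting on the system of party `k`. -/
def localOp {N : ℕ} {a : Fin N → ℕ} (k : Fin N) (A : Matrix (Loc a k) (Loc a k) ℂ) :
    Matrix (Glob a) (Glob a) ℂ :=
  fun x y => if ∀ i, i ≠ k → x i = y i then A (x k) (y k) else 0

/-- A quantum instrument (a general quantum operation with classical outcome) on a system with
basis labels `ι`. It has finitely many classical outcomes `j`; the completely positive map
belonging to outcome `j` is given by its Kraus operators `kraus j s`, and the sum of all these
maps is trace preserving. A measurement that keeps all information has one Kraus operator for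
each outcome; a deterministic channel has a single outcome. -/
structure Instrument (ι : Type) [Fintype ι] [DecidableEq ι] where
  outcomes : ℕ
  numKraus : Fin outcomes → ℕ
  kraus : (j : Fin outcomes) → Fin (numKraus j) → Matrix ι ι ℂ
  complete : ∑ j, ∑ s, (kraus j s)ᴴ * kraus j s = 1

/-- The unnormalized joint state after party `k` has applied `I` and obtained outcome `j`; its
trace is the probability of that outcome. -/
def Instrument.apply {N : ℕ} {a : Fin N → ℕ} {k : Fin N} (I : Instrument (Loc a k))
    (j : Fin I.outcomes) (ρ : Matrix (Glob a) (Glob a) ℂ) : Matrix (Glob a) (Glob a) ℂ :=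
  ∑ s, localOp k (I.kraus j s) * ρ * (localOp k (I.kraus j s))ᴴ

/-- LOCC protocols: either stop, or some party `k` applies an instrument to its own system and
announces the outcome `j` to everybody, after which the protocol `next j` is carried out. -/
inductive Protocol {N : ℕ} (a : Fin N → ℕ) : Type where
  | halt : Protocol a
  | step (k : Fin N) (I : Instrument (Loc a k)) (next : Fin I.outcomes → Protocol a) : Protocol a

/-- The rank-one operator `|ψ⟩⟨ψ|`. -/
def proj {ι : Type} (ψ : ι → ℂ) : Matrix ι ι ℂ := Matrix.vecMulVec ψ (star ψ)

/-- The joint state `|ψ⟩⟨ψ|` of the qubits, with every ancilla in its basis state `|0⟩`. -/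
def initial {N : ℕ} (a : Fin N → ℕ) (ψ : (Fin N → Fin 2) → ℂ) : Matrix (Glob a) (Glob a) ℂ :=
  proj (fun x => if ∀ k, (x k).2 = 0 then ψ (fun k => (x k).1) else 0)

/-- The partial trace over all ancillas. -/
def qubitState {N : ℕ} {a : Fin N → ℕ} (ρ : Matrix (Glob a) (Glob a) ℂ) :
    Matrix (Fin N → Fin 2) (Fin N → Fin 2) ℂ :=
  fun q r => ∑ c : (∀ k, Fin (a k + 1)), ρ (fun k => (q k, c k)) (fun k => (r k, c k))

open Classical in
/-- The probability that the protocol, started in the (unnormalized) joint state `ρ`, stops with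
the qubits in the pure state `φ`: the sum of the probabilities of all branches at whose end the
normalized state of the qubits is `|φ⟩⟨φ|`. -/
def successProb {N : ℕ} {a : Fin N → ℕ} (φ : (Fin N → Fin 2) → ℂ) :
    Protocol a → Matrix (Glob a) (Glob a) ℂ → ℝ
  | .halt, ρ => if qubitState ρ = ρ.trace • proj φ then ρ.trace.re else 0
  | .step _ I next, ρ => ∑ j, successProb φ (next j) (I.apply j ρ)

/-- The success probabilities of all LOCC protocols for the conversion of `ψ` into `φ`, with all
finite ancilla dimensions. -/
def achievable {N : ℕ} (ψ φ : (Fin N → Fin 2) → ℂ) : Set ℝ :=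
  {p | ∃ (a : Fin N → ℕ) (P : Protocol a), p = successProb φ P (initial a ψ)}

/-- The optimal LOCC success probability for the conversion of `ψ` into `φ`: the supremum over
all LOCC protocols. -/
def optimalProb {N : ℕ} (ψ φ : (Fin N → Fin 2) → ℂ) : ℝ := sSup (achievable ψ φ)

/-! The supremum above is a genuine least upper bound. -/

lemma localOp_conjTranspose {N : ℕ} {a : Fin N → ℕ} (k : Fin N)
    (A : Matrix (Loc a k) (Loc a k) ℂ) : (localOp k A)ᴴ = localOp k Aᴴ := by
  ext x y
  simp only [localOp, Matrix.conjTranspose_apply]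
  by_cases h : ∀ i, i ≠ k → x i = y i
  · rw [if_pos h, if_pos (fun i hi => (h i hi).symm)]
  · rw [if_neg h, if_neg (fun h' => h fun i hi => (h' i hi).symm), star_zero]

lemma localOp_mul {N : ℕ} {a : Fin N → ℕ} (k : Fin N) (A B : Matrix (Loc a k) (Loc a k) ℂ) :
    localOp k A * localOp k B = localOp k (A * B) := by
  ext x z
  simp only [Matrix.mul_apply, localOp]
  have hinj : Function.Injective (fun s : Loc a k => Function.update x k s) :=
    Function.update_injective x k
  have hsub : ∑ y : Glob a, (if ∀ i, i ≠ k → x i = y i then A (x k) (y k) else 0) *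
        (if ∀ i, i ≠ k → y i = z i then B (y k) (z k) else 0)
      = ∑ s : Loc a k, A (x k) s * (if ∀ i, i ≠ k → x i = z i then B s (z k) else 0) := by
    symm
    refine Finset.sum_of_injOn (fun s => Function.update x k s) hinj.injOn
      (fun _ _ => Finset.mem_coe.2 (Finset.mem_univ _)) ?_ ?_
    · intro y _ hy
      rw [if_neg, zero_mul]
      intro h
      refine hy ⟨y k, by simp, ?_⟩
      funext i
      by_cases hi : i = k
      · subst hi; simp
      · simp [Function.update_of_ne hi, h i hi]
    · intro s _
      have h1 : ∀ i, i ≠ k → x i = Function.update x k s i := fun i hi => by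
        simp [Function.update_of_ne hi]
      rw [if_pos h1]
      congr 1
      · simp
      · have h2 : (∀ i, i ≠ k → Function.update x k s i = z i) ↔ ∀ i, i ≠ k → x i = z i :=
          forall₂_congr fun i hi => by rw [h1 i hi]
        simp only [h2, Function.update_self]
  rw [hsub]
  split_ifs <;> simp

lemma localOp_one {N : ℕ} {a : Fin N → ℕ} (k : Fin N) :
    localOp k (1 : Matrix (Loc a k) (Loc a k) ℂ) = 1 := by
  ext x y
  simp only [localOp, Matrix.one_apply]
  by_cases h : x = y
  · subst h; simp
  · rw [if_neg h]
    split_ifs with h1 h2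
    · exact absurd (funext fun i => by
        by_cases hi : i = k
        · subst hi; exact h2
        · exact h1 i hi) h
    · rfl
    · rfl

lemma localOp_sum {N : ℕ} {a : Fin N → ℕ} (k : Fin N) {σ : Type} (s : Finset σ)
    (A : σ → Matrix (Loc a k) (Loc a k) ℂ) :
    localOp k (∑ i ∈ s, A i) = ∑ i ∈ s, localOp k (A i) := by
  ext x y
  simp only [localOp, Matrix.sum_apply]
  split_ifs <;> simp

lemma Instrument.apply_posSemidef {N : ℕ} {a : Fin N → ℕ} {k : Fin N}
    (I : Instrument (Loc a k)) (j : Fin I.outcomes) {ρ : Matrix (Glob a) (Glob a) ℂ}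
    (hρ : ρ.PosSemidef) : (I.apply j ρ).PosSemidef :=
  Matrix.posSemidef_sum _ fun _ _ => hρ.mul_mul_conjTranspose_same _

lemma Instrument.sum_trace_apply {N : ℕ} {a : Fin N → ℕ} {k : Fin N}
    (I : Instrument (Loc a k)) (ρ : Matrix (Glob a) (Glob a) ℂ) :
    ∑ j, (I.apply j ρ).trace = ρ.trace := by
  have h : ∑ j, ∑ s, (localOp k (I.kraus j s))ᴴ * localOp k (I.kraus j s)
      = (1 : Matrix (Glob a) (Glob a) ℂ) := by
    simp only [localOp_conjTranspose, localOp_mul, ← localOp_sum, I.complete, localOp_one]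
  calc ∑ j, (I.apply j ρ).trace
      = ((∑ j, ∑ s, (localOp k (I.kraus j s))ᴴ * localOp k (I.kraus j s)) * ρ).trace := by
        simp only [Instrument.apply, Matrix.trace_sum, Finset.sum_mul]
        refine Finset.sum_congr rfl fun j _ => Finset.sum_congr rfl fun s _ => ?_
        rw [Matrix.trace_mul_cycle]
    _ = ρ.trace := by rw [h, one_mul]

lemma successProb_le_trace {N : ℕ} {a : Fin N → ℕ} (φ : (Fin N → Fin 2) → ℂ)
    (P : Protocol a) : ∀ ρ : Matrix (Glob a) (Glob a) ℂ, ρ.PosSemidef →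
      successProb φ P ρ ≤ ρ.trace.re := by
  induction P with
  | halt =>
    intro ρ hρ
    have h0 : 0 ≤ ρ.trace.re := (Complex.le_def.1 hρ.trace_nonneg).1
    simp only [successProb]
    split_ifs
    · exact le_rfl
    · exact h0
  | step k I next ih =>
    intro ρ hρ
    simp only [successProb]
    calc ∑ j, successProb φ (next j) (I.apply j ρ)
        ≤ ∑ j, (I.apply j ρ).trace.re :=
          Finset.sum_le_sum fun j _ => ih j _ (I.apply_posSemidef j hρ)
      _ = ρ.trace.re := by rw [← Complex.re_sum, I.sum_trace_apply]

lemma trace_initial {N : ℕ} (a : Fin N → ℕ) (ψ : (Fin N → Fin 2) → ℂ) :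
    (initial a ψ).trace = ∑ q, ψ q * star (ψ q) := by
  simp only [initial, proj, Matrix.trace, Matrix.diag_apply, Matrix.vecMulVec_apply,
    Pi.star_apply]
  symm
  refine Finset.sum_of_injOn (fun q k => (q k, 0)) ?_
    (fun _ _ => Finset.mem_coe.2 (Finset.mem_univ _)) ?_ ?_
  · intro q _ r _ h
    funext k
    exact congrArg Prod.fst (congrFun h k)
  · intro x _ hx
    rw [if_neg, zero_mul]
    intro h
    exact hx ⟨fun k => (x k).1, by simp, funext fun k => Prod.ext rfl (h k).symm⟩
  · intro q _
    simp

lemma isLUB_optimalProb {N : ℕ} (ψ φ : (Fin N → Fin 2) → ℂ) :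
    IsLUB (achievable ψ φ) (optimalProb ψ φ) := by
  refine isLUB_csSup ⟨_, fun _ => 0, Protocol.halt, rfl⟩
    ⟨(∑ q, ψ q * star (ψ q)).re, ?_⟩
  rintro p ⟨a, P, rfl⟩
  rw [← trace_initial a ψ]
  exact successProb_le_trace φ P _ (Matrix.posSemidef_vecMulVec_self_star _)

end WClass

end

/-! Fix one party `p`. For an unnormalized pure state, `defect` is the squared norm minus the
largest eigenvalue of `p`'s reduced state. It cannot increase on average when any party measures
(`sum_defect_localOp_le`): the squared operator norm of the coefficient matrix is at most the sum of
those after the measurement, while the total squared norm is preserved.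

A mixed state is carried as a finite ensemble of unnormalized vectors, each Kraus operator refining
it (`successProb_le_sum_defect`). If a branch ends with the qubits exactly in W, purity forces every
member to be W times an ancilla vector (`exists_eq_tens_of_qubitState_eq`). The reduced state of W
is diag(1 - 1/N, 1/N), so a successful branch of probability q has total defect at least q/N.

Initially the reduced state has trace 1 and determinant (N - 1)t², so its smaller eigenvalue is (1 -
√(1 - 4(N-1)t²))/2 (`defect_initial_le`). Multiplying by N gives the bound. -/

noncomputable section

namespace WClass

open scoped Matrix.Norms.L2Operator

/-! ### Operator norms and families of Kraus operators -/

section Norms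

variable {ι κ : Type} [Fintype ι] [Fintype κ]

/-- The squared Euclidean norm of a complex vector. -/
def normSq (v : ι → ℂ) : ℝ := ∑ i, ‖v i‖ ^ 2

lemma normSq_nonneg (v : ι → ℂ) : 0 ≤ normSq v :=
  Finset.sum_nonneg fun _ _ => sq_nonneg _

lemma normSq_eq_norm_toLp (v : ι → ℂ) : normSq v = ‖WithLp.toLp 2 v‖ ^ 2 := by
  rw [EuclideanSpace.norm_sq_eq]; rfl

lemma normSq_star (v : ι → ℂ) : normSq (star v) = normSq v := by
  simp [normSq]

lemma ofReal_normSq (v : ι → ℂ) : ((normSq v : ℝ) : ℂ) = star v ⬝ᵥ v := by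
  simp [normSq, dotProduct, ← Complex.conj_mul']

lemma normSq_vecMul_eq (M : Matrix ι κ ℂ) (u : ι → ℂ) :
    normSq (u ᵥ* M) = normSq (Mᴴ *ᵥ star u) := by
  rw [← Matrix.star_vecMul, normSq_star]

variable [DecidableEq κ]

lemma normSq_mulVec_le (M : Matrix ι κ ℂ) (v : κ → ℂ) :
    normSq (M *ᵥ v) ≤ ‖M‖ ^ 2 * normSq v := by
  rw [normSq_eq_norm_toLp, normSq_eq_norm_toLp, ← mul_pow]
  exact pow_le_pow_left₀ (norm_nonneg _) (Matrix.l2_opNorm_mulVec M (WithLp.toLp 2 v)) 2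

lemma opNorm_sq_le_of_mulVec {M : Matrix ι κ ℂ} {L : ℝ} (hL : 0 ≤ L)
    (h : ∀ v, normSq (M *ᵥ v) ≤ L * normSq v) : ‖M‖ ^ 2 ≤ L := by
  rw [Matrix.l2_opNorm_def]
  refine (Real.le_sqrt (norm_nonneg _) hL).1 ?_
  refine ContinuousLinearMap.opNorm_le_bound _ (Real.sqrt_nonneg _) fun v => ?_
  refine le_of_sq_le_sq ?_ (by positivity)
  rw [mul_pow, Real.sq_sqrt hL]
  have := h v.ofLp
  rw [normSq_eq_norm_toLp, normSq_eq_norm_toLp] at this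
  exact this

variable [DecidableEq ι]

lemma normSq_vecMul_le (M : Matrix ι κ ℂ) (u : ι → ℂ) :
    normSq (u ᵥ* M) ≤ ‖M‖ ^ 2 * normSq u := by
  rw [normSq_vecMul_eq, ← normSq_star u, ← Matrix.l2_opNorm_conjTranspose M]
  exact normSq_mulVec_le _ _

lemma opNorm_sq_le_of_vecMul {M : Matrix ι κ ℂ} {L : ℝ} (hL : 0 ≤ L)
    (h : ∀ u, normSq (u ᵥ* M) ≤ L * normSq u) : ‖M‖ ^ 2 ≤ L := by
  rw [← Matrix.l2_opNorm_conjTranspose M]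
  refine opNorm_sq_le_of_mulVec hL fun v => ?_
  have := h (star v)
  rwa [normSq_vecMul_eq, normSq_star, star_star] at this

variable {σ : Type} [Fintype σ]

lemma sum_normSq_mulVec {K : σ → Matrix ι ι ℂ} (hK : ∑ s, (K s)ᴴ * K s = 1) (v : ι → ℂ) :
    ∑ s, normSq (K s *ᵥ v) = normSq v := by
  rw [← Complex.ofReal_inj, Complex.ofReal_sum]
  simp only [ofReal_normSq, Matrix.star_mulVec]
  calc ∑ s, star v ᵥ* (K s)ᴴ ⬝ᵥ K s *ᵥ v
      = ∑ s, star v ⬝ᵥ ((K s)ᴴ * K s) *ᵥ v := by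
        refine Finset.sum_congr rfl fun s _ => ?_
        rw [← Matrix.dotProduct_mulVec, Matrix.mulVec_mulVec]
    _ = star v ⬝ᵥ v := by
        rw [← dotProduct_sum, ← Matrix.sum_mulVec, hK, Matrix.one_mulVec]

/-- The Kraus family preserves total squared norm, so ‖Mv‖² is the sum of the ‖K_s M v‖², each at
most ‖K_s M‖²‖v‖². -/
lemma opNorm_sq_le_sum_mul_left {K : σ → Matrix ι ι ℂ} (hK : ∑ s, (K s)ᴴ * K s = 1)
    (M : Matrix ι κ ℂ) : ‖M‖ ^ 2 ≤ ∑ s, ‖K s * M‖ ^ 2 := by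
  refine opNorm_sq_le_of_mulVec (Finset.sum_nonneg fun _ _ => sq_nonneg _) fun v => ?_
  rw [← sum_normSq_mulVec hK, Finset.sum_mul]
  refine Finset.sum_le_sum fun s _ => ?_
  rw [Matrix.mulVec_mulVec]
  exact normSq_mulVec_le _ _

lemma opNorm_sq_le_sum_mul_right {K : σ → Matrix κ κ ℂ} (hK : ∑ s, (K s)ᴴ * K s = 1)
    (M : Matrix ι κ ℂ) : ‖M‖ ^ 2 ≤ ∑ s, ‖M * (K s)ᵀ‖ ^ 2 := by
  refine opNorm_sq_le_of_vecMul (Finset.sum_nonneg fun _ _ => sq_nonneg _) fun u => ?_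
  rw [← sum_normSq_mulVec hK, Finset.sum_mul]
  refine Finset.sum_le_sum fun s _ => ?_
  rw [← Matrix.vecMul_transpose, Matrix.vecMul_vecMul]
  exact normSq_vecMul_le _ _

end Norms

/-! ### Coefficient matrices and the defect -/

section Split

variable {ι : Type} [DecidableEq ι] {β : ι → Type}

/-- A vector of a composite system as a matrix whose rows are labelled by the basis of the
subsystem `p`; the columns are labelled by the whole basis, so that each column of the usual
coefficient matrix occurs once for each basis label of `p`. -/
def splitMatrix (p : ι) (ψ : (∀ k, β k) → ℂ) : Matrix (β p) (∀ k, β k) ℂ :=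
  fun s x => ψ (Function.update x p s)

lemma sum_sum_update [Fintype ι] [∀ k, Fintype (β k)] {R : Type} [Semiring R] (p : ι)
    (f : (∀ k, β k) → R) :
    ∑ x, ∑ s, f (Function.update x p s) = Fintype.card (β p) * ∑ x, f x := by
  calc ∑ x, ∑ s, f (Function.update x p s)
      = ∑ y : (∀ k, β k) × β p, f (Function.update y.1 p y.2) :=
        (Fintype.sum_prod_type' _).symm
    _ = ∑ y : (∀ k, β k) × β p, f y.1 :=
        -- Exchanging the entry at `p` with the spare label is an involution.
        Finset.sum_nbij' (fun y => (Function.update y.1 p y.2, y.1 p))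
          (fun y => (Function.update y.1 p y.2, y.1 p)) (by simp) (by simp) (by simp) (by simp)
          (by simp)
    _ = Fintype.card (β p) * ∑ x, f x := by
        rw [Fintype.sum_prod_type]
        simp [Finset.mul_sum]

variable [Fintype ι] [∀ k, Fintype (β k)] [∀ k, DecidableEq (β k)]

/-- The squared norm of `ψ` minus the largest eigenvalue of its reduced state on the
subsystem `p`. -/
def defect (p : ι) (ψ : (∀ k, β k) → ℂ) : ℝ :=
  normSq ψ - ‖splitMatrix p ψ‖ ^ 2 / Fintype.card (β p)

end Split

/-! ### Monotonicity of the defect under local measurements -/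

variable {N : ℕ} {a : Fin N → ℕ}

lemma localOp_mulVec (k : Fin N) (K : Matrix (Loc a k) (Loc a k) ℂ) (ψ : Glob a → ℂ)
    (x : Glob a) : (localOp k K *ᵥ ψ) x = ∑ s, K (x k) s * ψ (Function.update x k s) := by
  simp only [Matrix.mulVec, dotProduct, localOp]
  symm
  refine Finset.sum_of_injOn (fun s => Function.update x k s)
    (Function.update_injective x k).injOn (fun _ _ => Finset.mem_coe.2 (Finset.mem_univ _)) ?_ ?_
  · intro y _ hy
    rw [if_neg, zero_mul]
    intro h
    refine hy ⟨y k, by simp, ?_⟩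
    funext i
    by_cases hi : i = k
    · subst hi; simp
    · simp [Function.update_of_ne hi, h i hi]
  · intro s _
    rw [if_pos fun i hi => by simp [Function.update_of_ne hi]]
    simp

lemma splitMatrix_localOp_self (p : Fin N) (K : Matrix (Loc a p) (Loc a p) ℂ) (ψ : Glob a → ℂ) :
    splitMatrix p (localOp p K *ᵥ ψ) = K * splitMatrix p ψ := by
  ext s x
  rw [splitMatrix, localOp_mulVec, Matrix.mul_apply]
  simp [splitMatrix]

/-- Since columns carry the whole basis, the global operator itself can multiply on the right; it
commutes with overwriting the label at `p`. -/
lemma splitMatrix_localOp_of_ne {p k : Fin N} (h : k ≠ p) (K : Matrix (Loc a k) (Loc a k) ℂ)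
    (ψ : Glob a → ℂ) :
    splitMatrix p (localOp k K *ᵥ ψ) = splitMatrix p ψ * (localOp k K)ᵀ := by
  ext s x
  have : (splitMatrix p ψ * (localOp k K)ᵀ) s x = (localOp k K *ᵥ (splitMatrix p ψ s)) x := by
    rw [← Matrix.vecMul_transpose]; rfl
  rw [this, splitMatrix, localOp_mulVec, localOp_mulVec]
  refine Finset.sum_congr rfl fun r _ => ?_
  rw [splitMatrix, Function.update_comm h, Function.update_of_ne h]

lemma sum_conjTranspose_localOp_mul {k : Fin N} {σ : Type} [Fintype σ]
    {K : σ → Matrix (Loc a k) (Loc a k) ℂ} (hK : ∑ s, (K s)ᴴ * K s = 1) :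
    ∑ s, (localOp k (K s))ᴴ * localOp k (K s) = 1 := by
  simp only [localOp_conjTranspose, localOp_mul, ← localOp_sum, hK, localOp_one]

/-- The defect does not increase on average under a local measurement. -/
lemma sum_defect_localOp_le (p : Fin N) {k : Fin N} {σ : Type} [Fintype σ]
    {K : σ → Matrix (Loc a k) (Loc a k) ℂ} (hK : ∑ s, (K s)ᴴ * K s = 1) (ψ : Glob a → ℂ) :
    ∑ s, defect p (localOp k (K s) *ᵥ ψ) ≤ defect p ψ := by
  have hL := sum_conjTranspose_localOp_mul hK
  simp only [defect, Finset.sum_sub_distrib, sum_normSq_mulVec hL, ← Finset.sum_div]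
  gcongr
  by_cases h : k = p
  · subst h
    simp only [splitMatrix_localOp_self]
    exact opNorm_sq_le_sum_mul_left hK _
  · simp only [splitMatrix_localOp_of_ne h]
    exact opNorm_sq_le_sum_mul_right hL _

/-! ### Ensembles along a protocol -/

lemma mul_proj_mul {ι : Type} [Fintype ι] (K : Matrix ι ι ℂ) (ψ : ι → ℂ) :
    K * proj ψ * Kᴴ = proj (K *ᵥ ψ) := by
  rw [proj, proj, Matrix.mul_vecMulVec, Matrix.vecMulVec_mul, Matrix.star_mulVec]

lemma Instrument.apply_sum_proj {k : Fin N} (I : Instrument (Loc a k)) (j : Fin I.outcomes)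
    {ι : Type} [Fintype ι] (ψ : ι → Glob a → ℂ) :
    I.apply j (∑ i, proj (ψ i))
      = ∑ q : ι × Fin (I.numKraus j), proj (localOp k (I.kraus j q.2) *ᵥ ψ q.1) := by
  simp only [Instrument.apply, Finset.mul_sum, Finset.sum_mul, mul_proj_mul]
  rw [Finset.sum_comm, Fintype.sum_prod_type]

/-- If the trace of every ensemble representing the target is bounded by a multiple of the
average defect, then so is the success probability from any ensemble. -/
lemma successProb_le_sum_defect (p : Fin N) (φ : (Fin N → Fin 2) → ℂ) (C : ℝ)
    (hC : ∀ (ι : Type) [Fintype ι] (ψ : ι → Glob a → ℂ),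
      successProb φ Protocol.halt (∑ i, proj (ψ i)) ≤ C * ∑ i, defect p (ψ i))
    (hC0 : 0 ≤ C) (P : Protocol a) : ∀ (ι : Type) [Fintype ι] (ψ : ι → Glob a → ℂ),
      successProb φ P (∑ i, proj (ψ i)) ≤ C * ∑ i, defect p (ψ i) := by
  induction P with
  | halt => exact hC
  | step k I next ih =>
    intro ι _ ψ
    -- Outcomes and Kraus indices are pooled into one fine-grained measurement, to which
    -- monotonicity applies.
    have hI : ∑ q : (Σ j, Fin (I.numKraus j)), (I.kraus q.1 q.2)ᴴ * I.kraus q.1 q.2 = 1 := by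
      rw [Fintype.sum_sigma, ← I.complete]
    simp only [successProb]
    calc ∑ j, successProb φ (next j) (I.apply j (∑ i, proj (ψ i)))
        ≤ ∑ j, C * ∑ q : ι × Fin (I.numKraus j),
            defect p (localOp k (I.kraus j q.2) *ᵥ ψ q.1) := by
          refine Finset.sum_le_sum fun j _ => ?_
          rw [I.apply_sum_proj]
          exact ih j _ _
      _ = C * ∑ i, ∑ q : (Σ j, Fin (I.numKraus j)),
            defect p (localOp k (I.kraus q.1 q.2) *ᵥ ψ i) := by
          simp only [← Finset.mul_sum, Fintype.sum_prod_type, Fintype.sum_sigma]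
          rw [Finset.sum_comm]
      _ ≤ C * ∑ i, defect p (ψ i) := by
          gcongr with i
          exact sum_defect_localOp_le p hI (ψ i)

/-! ### Ensembles of a pure state -/

lemma norm_sum_mul_sq_le {ι : Type} [Fintype ι] (u v : ι → ℂ) :
    ‖∑ i, u i * v i‖ ^ 2 ≤ normSq u * normSq v := by
  calc ‖∑ i, u i * v i‖ ^ 2 ≤ (∑ i, ‖u i‖ * ‖v i‖) ^ 2 := by
        gcongr
        simpa only [norm_mul] using norm_sum_le Finset.univ fun i => u i * v i
    _ ≤ normSq u * normSq v := Finset.sum_mul_sq_le_sq_mul_sq _ _ _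

lemma trace_proj {ι : Type} [Fintype ι] (v : ι → ℂ) : (proj v).trace = (normSq v : ℝ) := by
  rw [ofReal_normSq, proj, Matrix.trace_vecMulVec, dotProduct_comm]

lemma normSq_sub_smul {ι : Type} [Fintype ι] {φ : ι → ℂ} (hφ : normSq φ = 1) (v : ι → ℂ) :
    normSq (v - (star φ ⬝ᵥ v) • φ) = normSq v - ‖star φ ⬝ᵥ v‖ ^ 2 := by
  have h1 : star φ ⬝ᵥ φ = 1 := by rw [← ofReal_normSq, hφ, Complex.ofReal_one]
  have h2 : star v ⬝ᵥ φ = star (star φ ⬝ᵥ v) := by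
    rw [← Matrix.star_dotProduct_star, star_star, dotProduct_comm]
  rw [← Complex.ofReal_inj, Complex.ofReal_sub, ofReal_normSq, ofReal_normSq, Complex.ofReal_pow,
    ← Complex.conj_mul', star_sub, star_smul]
  simp only [sub_dotProduct, dotProduct_sub, smul_dotProduct, dotProduct_smul, h1, h2,
    smul_eq_mul, starRingEnd_apply]
  ring

/-- The members of an ensemble representing a pure state are multiples of that state. -/
lemma eq_smul_of_sum_proj_eq {ι μ : Type} [Fintype ι] [Fintype μ] {φ : ι → ℂ}
    (hφ : normSq φ = 1) {T : ℂ} {v : μ → ι → ℂ} (h : ∑ m, proj (v m) = T • proj φ) (m : μ) :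
    v m = (star φ ⬝ᵥ v m) • φ := by
  have hT : ∑ m, ((normSq (v m) : ℝ) : ℂ) = T := by
    simpa [Matrix.trace_sum, trace_proj, hφ] using congrArg Matrix.trace h
  have hq (w : ι → ℂ) : star φ ⬝ᵥ (proj w *ᵥ φ) = ((‖star φ ⬝ᵥ w‖ ^ 2 : ℝ) : ℂ) := by
    have : star w ⬝ᵥ φ = star (star φ ⬝ᵥ w) := by
      rw [← Matrix.star_dotProduct_star, star_star, dotProduct_comm]
    rw [proj, Matrix.vecMulVec_mulVec, this, Complex.ofReal_pow, ← Complex.mul_conj',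
      starRingEnd_apply]
    simp [mul_comm]
  have hS : ∑ m, ((‖star φ ⬝ᵥ v m‖ ^ 2 : ℝ) : ℂ) = T := by
    have := congrArg (fun M => star φ ⬝ᵥ (M *ᵥ φ)) h
    simp only [Matrix.sum_mulVec, dotProduct_sum, hq, Matrix.smul_mulVec, dotProduct_smul] at this
    rw [this, ← ofReal_normSq, hφ]
    simp
  -- The trace and the expectation in `φ` both equal `T`, so no weight is left orthogonal to `φ`.
  have hsum : ∑ m, normSq (v m - (star φ ⬝ᵥ v m) • φ) = 0 := by
    simp only [normSq_sub_smul hφ, Finset.sum_sub_distrib]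
    rw [← Complex.ofReal_sum] at hT hS
    exact sub_eq_zero.2 (Complex.ofReal_injective (hT.trans hS.symm))
  have h0 := (Finset.sum_eq_zero_iff_of_nonneg fun m _ => normSq_nonneg _).1 hsum m
    (Finset.mem_univ _)
  have h1 := (Finset.sum_eq_zero_iff_of_nonneg fun i _ => sq_nonneg _).1 h0
  funext i
  have := h1 i (Finset.mem_univ _)
  exact sub_eq_zero.1 (by simpa using this)

/-! ### Products of qubit and ancilla states -/

lemma sum_glob {R : Type} [AddCommMonoid R] (f : Glob a → R) :
    ∑ x, f x = ∑ q : Fin N → Fin 2, ∑ c : (∀ k, Fin (a k + 1)), f fun k => (q k, c k) := by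
  rw [← Fintype.sum_prod_type'
    (f := fun (q : Fin N → Fin 2) (c : ∀ k, Fin (a k + 1)) => f fun k => (q k, c k))]
  exact Fintype.sum_equiv (Equiv.arrowProdEquivProdArrow (Fin N) (fun _ => Fin 2)
    fun k => Fin (a k + 1)) _ _ fun x => rfl

/-- The product of a state of the qubits and a state of the ancillas. -/
def tens (ψ : (Fin N → Fin 2) → ℂ) (χ : (∀ k, Fin (a k + 1)) → ℂ) : Glob a → ℂ :=
  fun x => ψ (fun k => (x k).1) * χ fun k => (x k).2

lemma normSq_tens (ψ : (Fin N → Fin 2) → ℂ) (χ : (∀ k, Fin (a k + 1)) → ℂ) :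
    normSq (tens ψ χ) = normSq ψ * normSq χ := by
  simp only [normSq, sum_glob, tens, norm_mul, mul_pow, Finset.sum_mul_sum]

lemma exists_eq_tens_of_qubitState_eq {φ : (Fin N → Fin 2) → ℂ} (hφ : normSq φ = 1) {T : ℂ}
    {ι : Type} [Fintype ι] {ψ : ι → Glob a → ℂ}
    (h : qubitState (∑ i, proj (ψ i)) = T • proj φ) (i : ι) : ∃ χ, ψ i = tens φ χ := by
  -- The partial trace is an ensemble of slices, one for each member and each ancilla configuration.
  have h' : ∑ m : ι × (∀ k, Fin (a k + 1)), proj (fun q => ψ m.1 fun k => (q k, m.2 k))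
      = T • proj φ := by
    rw [← h]
    ext q r
    simp only [qubitState, Matrix.sum_apply, Fintype.sum_prod_type]
    rw [Finset.sum_comm]
    rfl
  refine ⟨fun c => star φ ⬝ᵥ fun q => ψ i fun k => (q k, c k), funext fun x => ?_⟩
  have := congrFun (eq_smul_of_sum_proj_eq hφ h' (i, fun k => (x k).2)) fun k => (x k).1
  rw [tens, mul_comm]
  exact this

lemma normSq_vecMul_splitMatrix_tens (p : Fin N) (ψ : (Fin N → Fin 2) → ℂ)
    (χ : (∀ k, Fin (a k + 1)) → ℂ) (u : Loc a p → ℂ) :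
    normSq (u ᵥ* splitMatrix p (tens ψ χ))
      = ∑ e, normSq ((fun q => ∑ c, u (q, c) * χ (Function.update e p c)) ᵥ* splitMatrix p ψ) := by
  simp only [normSq, sum_glob]
  rw [Finset.sum_comm]
  refine Finset.sum_congr rfl fun e _ => Finset.sum_congr rfl fun x _ => ?_
  congr 2
  simp only [Matrix.vecMul, dotProduct, Fintype.sum_prod_type, Finset.sum_mul, splitMatrix, tens]
  refine Finset.sum_congr rfl fun q _ => Finset.sum_congr rfl fun c _ => ?_
  have h1 : (fun k => (Function.update (fun k => (x k, e k)) p (q, c) k).1)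
      = Function.update x p q := by
    funext k
    by_cases hk : k = p
    · subst hk; simp
    · simp [Function.update_of_ne hk]
  have h2 : (fun k => (Function.update (fun k => (x k, e k)) p (q, c) k).2)
      = Function.update e p c := by
    funext k
    by_cases hk : k = p
    · subst hk; simp
    · simp [Function.update_of_ne hk]
  rw [h1, h2]
  ring

lemma sum_normSq_update (χ : (∀ k, Fin (a k + 1)) → ℂ) (p : Fin N) :
    ∑ e, normSq (fun c => χ (Function.update e p c)) = (a p + 1) * normSq χ := by
  have := sum_sum_update p fun e => ‖χ e‖ ^ 2
  simpa [normSq] using this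

/-- Cauchy–Schwarz over `p`'s ancilla: tensoring with `χ` scales the eigenvalue bound by at most its
squared norm. The factor `a p + 1` is the multiplicity of repeated columns. -/
lemma opNorm_splitMatrix_tens_sq_le {p : Fin N} {ψ : (Fin N → Fin 2) → ℂ} {C : ℝ} (hC : 0 ≤ C)
    (h : ∀ w, normSq (w ᵥ* splitMatrix p ψ) ≤ C * normSq w) (χ : (∀ k, Fin (a k + 1)) → ℂ) :
    ‖splitMatrix p (tens ψ χ)‖ ^ 2 ≤ C * ((a p + 1) * normSq χ) := by
  have h0 := normSq_nonneg χ
  refine opNorm_sq_le_of_vecMul (by positivity) fun u => ?_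
  rw [normSq_vecMul_splitMatrix_tens]
  calc ∑ e, normSq ((fun q => ∑ c, u (q, c) * χ (Function.update e p c)) ᵥ* splitMatrix p ψ)
      ≤ ∑ e, C * (normSq u * normSq fun c => χ (Function.update e p c)) := by
        refine Finset.sum_le_sum fun e _ => (h _).trans ?_
        gcongr
        rw [normSq, normSq, Fintype.sum_prod_type, Finset.sum_mul]
        exact Finset.sum_le_sum fun q _ =>
          norm_sum_mul_sq_le (fun c => u (q, c)) fun c => χ (Function.update e p c)
    _ = C * ((a p + 1) * normSq χ) * normSq u := by
        rw [← Finset.mul_sum, ← Finset.mul_sum, sum_normSq_update]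
        ring

/-- Cauchy–Schwarz bounds the operator norm by the Hilbert–Schmidt norm. This covers the branches
that fail. -/
lemma defect_nonneg {ι : Type} [DecidableEq ι] [Fintype ι] {β : ι → Type}
    [∀ k, Fintype (β k)] [∀ k, DecidableEq (β k)] (p : ι) (ψ : (∀ k, β k) → ℂ) :
    0 ≤ defect p ψ := by
  have h0 := normSq_nonneg ψ
  refine sub_nonneg.2 (div_le_of_le_mul₀ (by positivity) h0 ?_)
  refine opNorm_sq_le_of_vecMul (by positivity) fun u => ?_
  calc normSq (u ᵥ* splitMatrix p ψ)
      ≤ ∑ x, normSq u * normSq fun s => ψ (Function.update x p s) :=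
        Finset.sum_le_sum fun x _ => norm_sum_mul_sq_le u fun s => ψ (Function.update x p s)
    _ = normSq ψ * Fintype.card (β p) * normSq u := by
        rw [← Finset.mul_sum]
        simp only [normSq]
        rw [sum_sum_update p fun x => ‖ψ x‖ ^ 2]
        ring

/-! ### Amplitudes and reduced states in the W class -/

lemma wState_zero (x : Fin N → ℝ) : wState x 0 = (√(1 - ∑ i, x i) : ℝ) := by
  have h (i : Fin N) : (0 : Fin N → Fin 2) ≠ Pi.single i 1 := fun h => by
    simpa using congrFun h i
  have h0 : (Pi.single (fun _ => 0) 1 : (Fin N → Fin 2) → ℂ) 0 = 1 := Pi.single_eq_same _ _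
  simp only [wState, Pi.add_apply, Pi.smul_apply, Finset.sum_apply, h0,
    Pi.single_eq_of_ne (h _)]
  simp

lemma wState_single (x : Fin N → ℝ) (i : Fin N) : wState x (Pi.single i 1) = (√(x i) : ℝ) := by
  have h : (Pi.single i 1 : Fin N → Fin 2) ≠ fun _ => 0 := fun h => by
    simpa using congrFun h i
  have h' (j : Fin N) (hj : j ≠ i) : (Pi.single i 1 : Fin N → Fin 2) ≠ Pi.single j 1 := fun h => by
    simpa [hj.symm] using congrFun h i
  simp only [wState, Pi.add_apply, Pi.smul_apply, Finset.sum_apply, Pi.single_eq_of_ne h,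
    smul_zero, zero_add]
  rw [Finset.sum_eq_single i]
  · simp
  · intro j _ hj
    simp [Pi.single_eq_of_ne (h' j hj)]
  · simp

lemma wState_eq_zero (x : Fin N → ℝ) {q : Fin N → Fin 2} (h0 : q ≠ 0)
    (h : ∀ i, q ≠ Pi.single i 1) : wState x q = 0 := by
  have h0' : q ≠ fun _ => 0 := h0
  simp [wState, Pi.single_eq_of_ne h0', Pi.single_eq_of_ne (h _)]

/-- The configurations that agree outside `p` with one of weight at most one. -/
def lowWeight (p : Fin N) (y : Option {i // i ≠ p} × Fin 2) : Fin N → Fin 2 :=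
  Function.update (y.1.elim 0 fun i => Pi.single i.1 1) p y.2

lemma update_lowWeight (p : Fin N) (y : Option {i // i ≠ p} × Fin 2) (q : Fin 2) :
    Function.update (lowWeight p y) p q = lowWeight p (y.1, q) := by
  simp [lowWeight]

lemma lowWeight_none_one (p : Fin N) : lowWeight p (none, 1) = Pi.single p 1 := rfl

lemma lowWeight_none_zero (p : Fin N) : lowWeight p (none, 0) = 0 := by
  simp [lowWeight]

lemma lowWeight_some_zero (p : Fin N) (i : {i // i ≠ p}) :
    lowWeight p (some i, 0) = Pi.single i.1 1 := by
  simp [lowWeight, Function.update_eq_self_iff, Pi.single_eq_of_ne i.2.symm]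

lemma lowWeight_some_apply (p : Fin N) (i : {i // i ≠ p}) (b : Fin 2) :
    lowWeight p (some i, b) i.1 = 1 := by
  simp [lowWeight, Function.update_of_ne i.2]

lemma lowWeight_apply_self (p : Fin N) (y : Option {i // i ≠ p} × Fin 2) :
    lowWeight p y p = y.2 := by
  simp [lowWeight]

lemma lowWeight_none_apply {p i : Fin N} (hi : i ≠ p) (b : Fin 2) :
    lowWeight p (none, b) i = 0 := by
  simp [lowWeight, Function.update_of_ne hi]

lemma lowWeight_some_apply_of_ne {p j : Fin N} {i : {i // i ≠ p}} (hj : j ≠ p) (hji : j ≠ i.1)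
    (b : Fin 2) : lowWeight p (some i, b) j = 0 := by
  simp [lowWeight, Function.update_of_ne hj, Pi.single_eq_of_ne hji]

lemma lowWeight_injective (p : Fin N) : Function.Injective (lowWeight p) := by
  rintro ⟨o, b⟩ ⟨o', b'⟩ h
  have hb : b = b' := by simpa [lowWeight_apply_self] using congrFun h p
  subst hb
  rcases o with _ | i <;> rcases o' with _ | j
  · rfl
  · have := congrFun h j.1
    simp [lowWeight_some_apply, lowWeight_none_apply j.2] at this
  · have := congrFun h i.1
    simp [lowWeight_some_apply, lowWeight_none_apply i.2] at this
  · by_cases hij : j.1 = i.1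
    · rw [Subtype.ext hij]
    · have := congrFun h j.1
      simp [lowWeight_some_apply, lowWeight_some_apply_of_ne j.2 hij] at this

lemma wState_lowWeight_some_one (x : Fin N → ℝ) (p : Fin N) (i : {i // i ≠ p}) :
    wState x (lowWeight p (some i, 1)) = 0 := by
  refine wState_eq_zero x (fun h => ?_) fun j h => ?_
  · simpa [lowWeight_apply_self] using congrFun h p
  · have hp : p = j := by
      by_contra hne
      simpa [lowWeight_apply_self, Pi.single_eq_of_ne hne] using congrFun h p
    have hi : i.1 = j := by
      by_contra hne
      simpa [lowWeight_some_apply, Pi.single_eq_of_ne hne] using congrFun h i.1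
    exact i.2 (hi.trans hp.symm)

lemma wState_update_eq_zero (x : Fin N → ℝ) {p : Fin N} {y : Fin N → Fin 2}
    (h : y ∉ Set.range (lowWeight p)) (q : Fin 2) : wState x (Function.update y p q) = 0 := by
  have key (z : Option {i // i ≠ p} × Fin 2) : Function.update y p q ≠ lowWeight p z := fun hz => by
    refine h ⟨(z.1, y p), ?_⟩
    have := congrArg (fun v => Function.update v p (y p)) hz
    simp only [Function.update_idem, Function.update_eq_self] at this
    rw [← update_lowWeight]
    exact this.symm
  refine wState_eq_zero x ?_ fun i => ?_
  · rw [← lowWeight_none_zero p]; exact key _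
  · by_cases hi : i = p
    · subst hi; rw [← lowWeight_none_one]; exact key _
    · have := key (some ⟨i, hi⟩, 0)
      rwa [lowWeight_some_zero] at this

/-- Only columns from `lowWeight` contribute: one with the other parties all in 0, and N - 1 with a
single excitation elsewhere. The factor 2 counts each column once per value of the bit at `p`. -/
lemma normSq_vecMul_splitMatrix_wState (p : Fin N) (t : ℝ) (w : Fin 2 → ℂ) :
    normSq (w ᵥ* splitMatrix p (wState fun _ : Fin N => t))
      = 2 * (‖w 0 * (√(1 - N * t) : ℝ) + w 1 * (√t : ℝ)‖ ^ 2
        + (N - 1) * ‖w 0 * (√t : ℝ)‖ ^ 2) := by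
  have hN : 1 ≤ N := Nat.one_le_of_lt p.2
  have hval (y : Option {i // i ≠ p} × Fin 2) :
      (w ᵥ* splitMatrix p (wState fun _ : Fin N => t)) (lowWeight p y)
        = w 0 * wState (fun _ => t) (lowWeight p (y.1, 0))
          + w 1 * wState (fun _ => t) (lowWeight p (y.1, 1)) := by
    simp [Matrix.vecMul, dotProduct, splitMatrix, update_lowWeight]
  rw [normSq, ← Fintype.sum_of_injective (lowWeight p) (lowWeight_injective p)
    (fun y => ‖(w ᵥ* splitMatrix p (wState fun _ : Fin N => t)) (lowWeight p y)‖ ^ 2) _ ?_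
    fun _ => rfl]
  · simp only [hval, Fintype.sum_prod_type, Fintype.sum_option, lowWeight_none_zero,
      lowWeight_none_one, lowWeight_some_zero, wState_lowWeight_some_one, wState_zero,
      wState_single]
    simp [Fintype.card_subtype_compl, Nat.cast_sub hN]
    ring
  · intro y hy
    simp [Matrix.vecMul, dotProduct, splitMatrix, wState_update_eq_zero _ hy]

/-- The two unit row vectors give the diagonal of the reduced state, hence its trace. -/
lemma normSq_wState_const {t : ℝ} (p : Fin N) (ht0 : 0 ≤ t) (htN : N * t ≤ 1) :
    normSq (wState fun _ : Fin N => t) = 1 := by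
  have h (q : Fin 2) := normSq_vecMul_splitMatrix_wState p t (Pi.single q 1)
  have h2 := sum_sum_update p fun y => ‖wState (fun _ : Fin N => t) y‖ ^ 2
  rw [Finset.sum_comm, Fin.sum_univ_two] at h2
  have e (q : Fin 2) : ∑ x, ‖wState (fun _ : Fin N => t) (Function.update x p q)‖ ^ 2
      = normSq (Pi.single q 1 ᵥ* splitMatrix p (wState fun _ : Fin N => t)) := by
    rw [Matrix.single_one_vecMul]; rfl
  rw [e, e, h, h] at h2
  simp [Real.sq_sqrt ht0, Real.sq_sqrt (sub_nonneg.2 htN), abs_of_nonneg,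
    Real.sqrt_nonneg] at h2
  rw [normSq]
  linarith

lemma normSq_standardW (hN : 2 ≤ N) : normSq (standardW N) = 1 := by
  have : (N : ℝ) ≠ 0 := by positivity
  exact normSq_wState_const ⟨0, by omega⟩ (by positivity) (by field_simp; rfl)

/-! ### Defect of the target -/

lemma normSq_le_mul_defect_tens_standardW (hN : 2 ≤ N) (p : Fin N)
    (χ : (∀ k, Fin (a k + 1)) → ℂ) :
    normSq (tens (standardW N) χ) ≤ N * defect p (tens (standardW N) χ) := by
  have hN' : (2 : ℝ) ≤ N := by exact_mod_cast hN
  have hN0 : (N : ℝ) ≠ 0 := by positivity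
  -- The constant is the column multiplicity 2 times 1 - 1/N, which is the larger eigenvalue because
  -- N ≥ 2.
  have h := opNorm_splitMatrix_tens_sq_le (p := p) (ψ := standardW N) (C := 2 * (1 - 1 / N))
    (by
      have : 1 / (N : ℝ) ≤ 1 := by rw [div_le_one] <;> linarith
      linarith)
    (fun w => by
      rw [standardW, normSq_vecMul_splitMatrix_wState, normSq, Fin.sum_univ_two]
      have h0 : (N : ℝ) * (1 / N) = 1 := by field_simp
      have h1 : (1 / (N : ℝ)) ≤ 1 - 1 / N := by
        rw [div_le_iff₀ (by positivity), sub_mul, mul_comm (1 / (N : ℝ)), h0]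
        linarith
      have h2 : ((N : ℝ) - 1) * (1 / N) = 1 - 1 / N := by rw [sub_mul, h0, one_mul]
      rw [h0, sub_self, Real.sqrt_zero, Complex.ofReal_zero, mul_zero, zero_add, norm_mul,
        norm_mul, mul_pow, mul_pow, Complex.norm_real, Real.norm_eq_abs, sq_abs,
        Real.sq_sqrt (by positivity)]
      have := mul_le_mul_of_nonneg_left h1 (sq_nonneg ‖w 1‖)
      linear_combination 2 * this + 2 * ‖w 0‖ ^ 2 * h2)
    χ
  have hd : ‖splitMatrix p (tens (standardW N) χ)‖ ^ 2 / Fintype.card (Loc a p)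
      ≤ (1 - 1 / N) * normSq χ := by
    rw [div_le_iff₀ (by exact_mod_cast Fintype.card_pos)]
    refine h.trans_eq ?_
    simp
    ring
  rw [defect, normSq_tens, normSq_standardW hN, one_mul]
  calc normSq χ = N * (normSq χ - (1 - 1 / N) * normSq χ) := by field_simp; ring
    _ ≤ _ := by gcongr

lemma successProb_halt_standardW_le (hN : 2 ≤ N) (p : Fin N) {ι : Type} [Fintype ι]
    (ψ : ι → Glob a → ℂ) :
    successProb (standardW N) Protocol.halt (∑ i, proj (ψ i)) ≤ N * ∑ i, defect p (ψ i) := by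
  rw [successProb]
  split_ifs with h
  · rw [Matrix.trace_sum, Complex.re_sum, Finset.mul_sum]
    refine Finset.sum_le_sum fun i _ => ?_
    obtain ⟨χ, hχ⟩ := exists_eq_tens_of_qubitState_eq (normSq_standardW hN) h i
    rw [trace_proj, Complex.ofReal_re, hχ]
    exact normSq_le_mul_defect_tens_standardW hN p χ
  · exact mul_nonneg (Nat.cast_nonneg _) (Finset.sum_nonneg fun i _ => defect_nonneg p _)

/-! ### Defect of the initial state -/

/-- The state of the ancillas before the protocol. -/
def ancillaZero (a : Fin N → ℕ) : (∀ k, Fin (a k + 1)) → ℂ := Pi.single 0 1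

lemma normSq_ancillaZero : normSq (ancillaZero a) = 1 := by
  rw [normSq, Finset.sum_eq_single 0]
  · simp [ancillaZero]
  · intro c _ hc
    simp [ancillaZero, Pi.single_eq_of_ne hc]
  · simp

lemma initial_eq_proj_tens (ψ : (Fin N → Fin 2) → ℂ) :
    initial a ψ = proj (tens ψ (ancillaZero a)) := by
  rw [initial]
  congr 1
  funext x
  simp [tens, ancillaZero, Pi.single_apply, funext_iff]

/-- Testing the operator norm on `w` tensored with the ancilla basis state 0 shows that a fresh
ancilla does not lower the largest eigenvalue. -/
lemma normSq_vecMul_splitMatrix_le_opNorm_tens (p : Fin N) (ψ : (Fin N → Fin 2) → ℂ)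
    (w : Fin 2 → ℂ) :
    (a p + 1) * normSq (w ᵥ* splitMatrix p ψ)
      ≤ ‖splitMatrix p (tens ψ (ancillaZero a))‖ ^ 2 * normSq w := by
  have h := normSq_vecMul_le (splitMatrix p (tens ψ (ancillaZero a)))
    fun s => if s.2 = 0 then w s.1 else 0
  have h1 : normSq (fun s : Loc a p => if s.2 = 0 then w s.1 else 0) = normSq w := by
    simp only [normSq, Fintype.sum_prod_type]
    refine Finset.sum_congr rfl fun q _ => ?_
    rw [Finset.sum_eq_single 0] <;> simp +contextual
  rw [h1, normSq_vecMul_splitMatrix_tens] at h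
  refine le_trans (le_of_eq ?_) h
  have h2 (e : ∀ k, Fin (a k + 1)) :
      normSq ((fun q => ∑ c : Fin (a p + 1), (if c = 0 then w q else 0)
        * ancillaZero a (Function.update e p c)) ᵥ* splitMatrix p ψ)
      = normSq (w ᵥ* splitMatrix p ψ)
        * normSq fun c => ancillaZero a (Function.update e p c) := by
    have h3 : normSq (fun c => ancillaZero a (Function.update e p c))
        = ‖ancillaZero a (Function.update e p 0)‖ ^ 2 := by
      rw [normSq, Finset.sum_eq_single 0]
      · intro c _ hc
        rw [ancillaZero, Pi.single_eq_of_ne fun h => hc (by simpa using congrFun h p)]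
        simp
      · simp
    have h4 : (fun q => ∑ c : Fin (a p + 1), (if c = 0 then w q else 0)
        * ancillaZero a (Function.update e p c)) = ancillaZero a (Function.update e p 0) • w := by
      funext q
      simp [mul_comm]
    rw [h3, h4, Matrix.smul_vecMul, normSq, normSq, Finset.sum_mul]
    simp [mul_pow, mul_comm]
  simp only [h2]
  rw [← Finset.mul_sum, sum_normSq_update, normSq_ancillaZero]
  ring

lemma defect_initial_le (hN : 2 ≤ N) (p : Fin N) {t : ℝ} (ht0 : 0 ≤ t) (htN : N * t ≤ 1) :
    defect p (tens (wState fun _ : Fin N => t) (ancillaZero a))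
      ≤ (1 - √(1 - 4 * ((N : ℝ) - 1) * t ^ 2)) / 2 := by
  have hN' : (2 : ℝ) ≤ N := by exact_mod_cast hN
  rw [defect, normSq_tens, normSq_ancillaZero, normSq_wState_const p ht0 htN]
  set L : ℝ := ‖splitMatrix p (tens (wState fun _ : Fin N => t) (ancillaZero a))‖ ^ 2
    / Fintype.card (Loc a p) with hL
  have hs : 0 ≤ 1 - N * t := sub_nonneg.2 htN
  obtain ⟨c, hc⟩ : ∃ c, c = √t * √(1 - N * t) := ⟨_, rfl⟩
  have hc2 : c ^ 2 = t * (1 - N * t) := by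
    rw [hc, mul_pow, Real.sq_sqrt ht0, Real.sq_sqrt hs]
  -- The reduced state is the real matrix with rows (1 - t, c) and (c, t), so real test vectors
  -- suffice.
  have key (x y : ℝ) : (1 - t) * x ^ 2 + 2 * c * x * y + t * y ^ 2 ≤ L * (x ^ 2 + y ^ 2) := by
    have h := normSq_vecMul_splitMatrix_le_opNorm_tens (a := a) p (wState fun _ : Fin N => t)
      ![(x : ℂ), y]
    have hcard : (Fintype.card (Loc a p) : ℝ) = 2 * (a p + 1) := by simp
    have hpos : (0 : ℝ) < a p + 1 := by positivity
    have hL' : ‖splitMatrix p (tens (wState fun _ : Fin N => t) (ancillaZero a))‖ ^ 2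
        = L * (2 * (a p + 1)) := by
      rw [hL, hcard]; field_simp
    rw [hL', normSq_vecMul_splitMatrix_wState, normSq, Fin.sum_univ_two] at h
    simp only [Matrix.cons_val_zero, Matrix.cons_val_one, ← Complex.ofReal_mul,
      ← Complex.ofReal_add, Complex.norm_real, Real.norm_eq_abs, sq_abs, mul_pow,
      Real.sq_sqrt ht0] at h
    have h' : (x * √(1 - N * t) + y * √t) ^ 2 + (N - 1) * (x ^ 2 * t) ≤ L * (x ^ 2 + y ^ 2) := by
      refine le_of_mul_le_mul_left ?_ (mul_pos two_pos hpos)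
      linarith
    have e : (x * √(1 - N * t) + y * √t) ^ 2
        = x ^ 2 * (1 - N * t) + 2 * c * x * y + y ^ 2 * t := by
      rw [hc]
      linear_combination x ^ 2 * Real.sq_sqrt hs + y ^ 2 * Real.sq_sqrt ht0
    rw [e] at h'
    linarith
  have h1 : 1 - t ≤ L := by simpa using key 1 0
  -- Nonpositive discriminant means L² - L + (N - 1)t² ≥ 0, that is, (2L - 1)² ≥ 1 - 4(N - 1)t².
  have hd := discrim_le_zero (a := L - (1 - t)) (b := -2 * c) (c := L - t) fun x => by
    have := key x 1
    linarith
  rw [discrim] at hd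
  -- With `h1` this gives L ≥ 1/2, selecting the larger root.
  have ht : t ≤ 1 / 2 := by nlinarith
  have : √(1 - 4 * ((N : ℝ) - 1) * t ^ 2) ≤ 2 * L - 1 :=
    (Real.sqrt_le_left (by linarith)).2 (by nlinarith)
  linarith

end WClass

end

theorem mainTheorem4 (N : ℕ) (hN : 2 ≤ N) (t : ℝ) (ht0 : 0 ≤ t) (htN : t ≤ 1 / (N : ℝ)) :
    WClass.optimalProb (WClass.wState (fun _ : Fin N => t)) (WClass.standardW N)
        ≤ (N : ℝ) / 2 * (1 - √(1 - 4 * ((N : ℝ) - 1) * t ^ 2)) ∧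
      (0 < t → t < 1 / (N : ℝ) →
        (N : ℝ) / 2 * (1 - √(1 - 4 * ((N : ℝ) - 1) * t ^ 2)) < (N : ℝ) * t) := by
  have hN' : (2 : ℝ) ≤ N := by exact_mod_cast hN
  have hN0 : (0 : ℝ) < N := by linarith
  constructor
  · refine (WClass.isLUB_optimalProb _ _).2 ?_
    rintro _ ⟨a, P, rfl⟩
    have h := WClass.successProb_le_sum_defect ⟨0, by omega⟩ (WClass.standardW N) N
      (fun _ _ ψ => WClass.successProb_halt_standardW_le hN _ ψ) hN0.le P Unit
      fun _ => WClass.tens (WClass.wState fun _ : Fin N => t) (WClass.ancillaZero a)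
    simp only [Finset.univ_unique, Finset.sum_singleton] at h
    rw [WClass.initial_eq_proj_tens]
    have hd := WClass.defect_initial_le (a := a) hN ⟨0, by omega⟩ ht0
      (by rwa [le_div_iff₀ hN0, mul_comm] at htN)
    calc _ ≤ _ := h
      _ ≤ N * ((1 - √(1 - 4 * ((N : ℝ) - 1) * t ^ 2)) / 2) := by gcongr
      _ = _ := by ring
  · intro h0 h1
    rw [lt_div_iff₀ hN0] at h1
    -- After squaring, this is N t² < t.
    have : 1 - 2 * t < √(1 - 4 * ((N : ℝ) - 1) * t ^ 2) :=
      Real.lt_sqrt_of_sq_lt (by nlinarith)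
    nlinarith
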